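/- Let $\rho>0$, let $(a_i)_{i\ge1}$ be positive real numbers with $\sum_{i=1}^\infty a_i=1$, and let $(z_i)_{i\ge1}$ be distinct complex numbers with $|z_i|<\rho$ for all $i$ and $\lim_{i\to\infty}z_i=\rho$. Put $D=\{z\in\mathbb C:|z|<\rho\}$. Then the series $$f(z)=\sum_{i=1}^{\infty}\frac{a_i}{z-z_i}$$ converges absolutely for every $z\in D\setminus\{z_i\}_{i\ge1}$ and defines a function that is holomorphic on $D\setminus\{z_i\}_{i\ge1}$ and meromorphic in $D$, and the set of zeros of $f$ in $D$ has no accumulation point in $D$. If this set of zeros is non-empty, let $\{w_j\}_{j}$ be the (finite or infinite) list of the zeros of $f$ in $D$, each repeated according to its multiplicity. Then for all $\lambda\in\mathbb C\setminus\{0\}$, all $\mu\in\mathbb C$ and every nonnegative convex function $\Phi:\mathbb C\to\mathbb R$, $$\sum_{j}\Phi(\lambda w_j+\mu)\ \le\ \sum_{i=1}^{\infty}(1-a_i)\,\Phi(\lambda z_i+\mu),$$ where both sides are sums of nonnegative terms with values in $[0,\infty]$. -/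

import Mathlib

open Filter Topology Set
open scoped ENNReal

noncomputable section

/-- The Borel series `f(ζ) = ∑ i, a i / (ζ - z i)`: the field created by charges `a i` at `z i`. -/
def borelField (a : ℕ → ℝ) (z : ℕ → ℂ) (ζ : ℂ) : ℂ :=
  ∑' i, (a i : ℂ) / (ζ - z i)

/-- The open disk of radius `ρ` about the origin with the points `z i` removed. -/
def puncturedDisk (ρ : ℝ) (z : ℕ → ℂ) : Set ℂ :=
  Metric.ball (0 : ℂ) ρ \ Set.range z

/-- The zeros of `f` in the open disk of radius `ρ`. The poles `z i` are excluded explicitly,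
because division by zero in Lean gives `borelField` a meaningless finite value there. -/
def fieldZeros (ρ : ℝ) (a : ℕ → ℝ) (z : ℕ → ℂ) : Set ℂ :=
  {w | w ∈ puncturedDisk ρ z ∧ borelField a z w = 0}

end

/-! In `ℓ²` let `v = (√a i)`, a unit vector, and let `T` be the diagonal operator with entries `z
i`. A point `w` off the `z i` is a zero of `f` exactly when `(T - w)⁻¹ v ⟂ v`, so the zeros are
eigenvalues of the compression of `T` to `vᗮ`. Multiplicities are handled by the chain `y k = v / ∏
j ≤ k, (z - w j)`, which stays orthogonal to `v` as long as no zero is repeated beyond its order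
(`hasSum_dividedCoeff_zero`).

Gram–Schmidt on this chain gives orthonormal `e k ⟂ v` with `⟨e k, T (e k)⟩ = w k`
(`inner_gramSchmidtNormed_of_chain`). Hence `w k = ∑ i, ‖e k i‖ ^ 2 * z i` is a convex combination
of the `z i`, and Jensen (`ConvexOn.ofReal_map_le_tsum`) bounds `Φ (l * w k + m)`. Summed over `k`,
the weight at `z i` is at most `1 - a i`: Bessel applied to the projection of the `i`-th basis
vector onto `vᗮ` (`sum_norm_sq_apply_le`). Finite lists of zeros suffice, since the left side is a
supremum of finite sums. -/

/-! ### Analyticity, poles and orders of Cauchy series -/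

/-- The series `∑ i, b i / (ζ - z i)` with complex coefficients. -/
noncomputable def cauchySeries (b z : ℕ → ℂ) (ζ : ℂ) : ℂ :=
  ∑' i, b i / (ζ - z i)

theorem summable_norm_div {b z : ℕ → ℂ} (hb : Summable fun i => ‖b i‖) {ζ : ℂ} {δ : ℝ}
    (hδ : 0 < δ) (h : ∀ i, b i = 0 ∨ δ ≤ ‖ζ - z i‖) : Summable fun i => ‖b i / (ζ - z i)‖ := by
  refine Summable.of_nonneg_of_le (fun _ => norm_nonneg _) (fun i => ?_) (hb.div_const δ)
  rcases h i with h | h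
  · simp [h]
  · rw [norm_div]
    gcongr

/-- A bound uniform in `i` makes the series converge uniformly near `ζ`. Allowing `b i = 0` lets `ζ`
be a pole location whose own term has been deleted. -/
theorem analyticAt_cauchySeries {b z : ℕ → ℂ} (hb : Summable fun i => ‖b i‖) {ζ : ℂ} {δ : ℝ}
    (hδ : 0 < δ) (h : ∀ i, b i = 0 ∨ δ ≤ ‖ζ - z i‖) : AnalyticAt ℂ (cauchySeries b z) ζ := by
  have far : ∀ w ∈ Metric.ball ζ (δ / 2), ∀ i, b i = 0 ∨ δ / 2 ≤ ‖w - z i‖ := by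
    intro w hw i
    refine (h i).imp id fun h => ?_
    have h1 : ‖ζ - z i‖ ≤ ‖w - ζ‖ + ‖w - z i‖ := by
      rw [norm_sub_rev w ζ]
      simpa using norm_add_le (ζ - w) (w - z i)
    have h2 : ‖w - ζ‖ < δ / 2 := by simpa [dist_eq_norm] using hw
    linarith
  have hd : DifferentiableOn ℂ (cauchySeries b z) (Metric.ball ζ (δ / 2)) := by
    refine Complex.differentiableOn_tsum_of_summable_norm (hb.div_const (δ / 2)) (fun i => ?_)
      Metric.isOpen_ball fun i w hw => ?_
    · intro w hw
      rcases far w hw i with h | h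
      · simp [h, differentiableWithinAt_const]
      · refine DifferentiableAt.differentiableWithinAt ?_
        have : w - z i ≠ 0 := norm_pos_iff.1 (by linarith)
        fun_prop (disch := assumption)
    · rcases far w hw i with h | h
      · simp [h]
      · rw [norm_div]
        gcongr
  exact hd.analyticAt (Metric.ball_mem_nhds _ (by positivity))

/-- A point of the punctured disk keeps a positive distance from a sequence converging to the
boundary. -/
theorem exists_pos_le_norm_sub {ρ : ℝ} {z : ℕ → ℂ} (hlim : Tendsto z atTop (𝓝 (ρ : ℂ)))
    {ζ : ℂ} (hζ : ‖ζ‖ < ρ) :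
    ∃ δ > 0, ∀ i, z i ≠ ζ → δ ≤ ‖ζ - z i‖ := by
  have hne : ζ ≠ (ρ : ℂ) := by
    rintro rfl
    rw [Complex.norm_real] at hζ
    exact absurd hζ (not_lt.2 (le_abs_self ρ))
  have hpos : 0 < ‖ζ - ρ‖ := norm_pos_iff.2 (sub_ne_zero.2 hne)
  have hev : ∀ᶠ i in atTop, ‖ζ - ρ‖ / 2 < ‖ζ - z i‖ :=
    ((tendsto_const_nhds.sub hlim).norm).eventually_const_lt (by linarith)
  obtain ⟨N, hN⟩ := eventually_atTop.1 hev
  have key : ∀ N, ∃ δ > 0, ∀ i < N, z i ≠ ζ → δ ≤ ‖ζ - z i‖ := by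
    intro N
    induction N with
    | zero => exact ⟨1, one_pos, fun i hi => absurd hi (by simp)⟩
    | succ N ih =>
      obtain ⟨δ, hδ, h⟩ := ih
      by_cases hz : z N = ζ
      · refine ⟨δ, hδ, fun i hi hne => ?_⟩
        rcases Nat.lt_succ_iff_lt_or_eq.1 hi with hi | rfl
        · exact h i hi hne
        · exact absurd hz hne
      · refine ⟨min δ ‖ζ - z N‖, lt_min hδ (norm_pos_iff.2 (sub_ne_zero.2 (Ne.symm hz))),
          fun i hi hne => ?_⟩
        rcases Nat.lt_succ_iff_lt_or_eq.1 hi with hi | rfl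
        · exact (min_le_left _ _).trans (h i hi hne)
        · exact min_le_right _ _
  obtain ⟨δ, hδ, h⟩ := key N
  refine ⟨min δ (‖ζ - ρ‖ / 2), lt_min hδ (by positivity), fun i hi => ?_⟩
  rcases lt_or_ge i N with hiN | hiN
  · exact (min_le_left _ _).trans (h i hiN hi)
  · exact (min_le_right _ _).trans (hN i hiN).le

theorem puncturedDisk_far {ρ : ℝ} {z : ℕ → ℂ} (hlim : Tendsto z atTop (𝓝 (ρ : ℂ)))
    {ζ : ℂ} (hζ : ζ ∈ puncturedDisk ρ z) : ∃ δ > 0, ∀ i, δ ≤ ‖ζ - z i‖ := by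
  obtain ⟨δ, hδ, h⟩ := exists_pos_le_norm_sub hlim (mem_ball_zero_iff.1 hζ.1)
  exact ⟨δ, hδ, fun i => h i fun hi => hζ.2 ⟨i, hi⟩⟩

theorem analyticAt_cauchySeries_of_mem {ρ : ℝ} {b z : ℕ → ℂ} (hb : Summable fun i => ‖b i‖)
    (hlim : Tendsto z atTop (𝓝 (ρ : ℂ))) {ζ : ℂ} (hζ : ζ ∈ puncturedDisk ρ z) :
    AnalyticAt ℂ (cauchySeries b z) ζ := by
  obtain ⟨δ, hδ, h⟩ := puncturedDisk_far hlim hζ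
  exact analyticAt_cauchySeries hb hδ fun i => Or.inr (h i)

/-- Near a point `z k` with nonzero coefficient, the series is a simple pole plus an analytic
function. -/
theorem exists_analyticAt_eventually_eq_pole_add {ρ : ℝ} {b z : ℕ → ℂ}
    (hb : Summable fun i => ‖b i‖) (hz : Function.Injective z) (hlim : Tendsto z atTop (𝓝 (ρ : ℂ)))
    (k : ℕ) (hk : ‖z k‖ < ρ) :
    ∃ g : ℂ → ℂ, AnalyticAt ℂ g (z k) ∧
      ∀ᶠ ζ in 𝓝[≠] (z k), cauchySeries b z ζ = b k / (ζ - z k) + g ζ := by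
  obtain ⟨δ, hδ, h⟩ := exists_pos_le_norm_sub hlim hk
  have hb' : Summable fun i => ‖Function.update b k 0 i‖ := by
    refine Summable.of_nonneg_of_le (fun _ => norm_nonneg _) (fun i => ?_) hb
    rcases eq_or_ne i k with rfl | hi
    · simp
    · simp [hi]
  refine ⟨cauchySeries (Function.update b k 0) z, analyticAt_cauchySeries hb' hδ fun i => ?_, ?_⟩
  · rcases eq_or_ne i k with rfl | hi
    · simp
    · exact Or.inr (h i (hz.ne hi))
  · have hball : Metric.ball (z k) (δ / 2) ∈ 𝓝[≠] (z k) :=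
      mem_nhdsWithin_of_mem_nhds (Metric.ball_mem_nhds _ (by positivity))
    filter_upwards [hball] with ζ hζ
    have hs : Summable fun i => Function.update b k 0 i / (ζ - z i) := by
      refine (summable_norm_div hb' (half_pos hδ) fun i => ?_).of_norm
      rcases eq_or_ne i k with rfl | hi
      · simp
      · right
        have h1 : ‖z k - z i‖ ≤ ‖ζ - z k‖ + ‖ζ - z i‖ := by
          rw [norm_sub_rev ζ (z k)]
          simpa using norm_add_le (z k - ζ) (ζ - z i)
        have h2 : ‖ζ - z k‖ < δ / 2 := by simpa [dist_eq_norm] using hζ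
        have h3 := h i (hz.ne hi)
        linarith
    have hs2 : HasSum (fun i => if i = k then b k / (ζ - z k) else 0) (b k / (ζ - z k)) :=
      hasSum_ite_eq k _
    refine ((hs2.add hs.hasSum).congr_fun ?_).tsum_eq
    intro i
    rcases eq_or_ne i k with rfl | hi
    · simp
    · simp [hi]

theorem meromorphicOn_cauchySeries {ρ : ℝ} {b z : ℕ → ℂ}
    (hb : Summable fun i => ‖b i‖) (hz : Function.Injective z)
    (hlim : Tendsto z atTop (𝓝 (ρ : ℂ))) :
    MeromorphicOn (cauchySeries b z) (Metric.ball 0 ρ) := by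
  intro ζ hζ
  by_cases h : ζ ∈ range z
  · obtain ⟨k, rfl⟩ := h
    obtain ⟨g, hg, he⟩ := exists_analyticAt_eventually_eq_pole_add hb hz hlim k (by simpa using hζ)
    refine MeromorphicAt.congr ?_ (he.mono fun _ h => h.symm)
    have := hg.meromorphicAt
    fun_prop
  · exact (analyticAt_cauchySeries_of_mem hb hlim ⟨hζ, h⟩).meromorphicAt

/-- If the series vanished near `z k`, multiplying by `ζ - z k` and letting `ζ → z k` would give `b
k = 0`. Finiteness of the order then spreads over the connected disk. -/
theorem meromorphicOrderAt_cauchySeries_ne_top {ρ : ℝ} {b z : ℕ → ℂ}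
    (hb : Summable fun i => ‖b i‖) (hz : Function.Injective z)
    (hlim : Tendsto z atTop (𝓝 (ρ : ℂ))) {k : ℕ} (hk : ‖z k‖ < ρ) (hbk : b k ≠ 0) {ζ : ℂ}
    (hζ : ζ ∈ Metric.ball (0 : ℂ) ρ) :
    meromorphicOrderAt (cauchySeries b z) ζ ≠ ⊤ := by
  refine (meromorphicOn_cauchySeries hb hz hlim).meromorphicOrderAt_ne_top_of_isPreconnected
    (convex_ball (0 : ℂ) ρ).isPreconnected (mem_ball_zero_iff.2 hk) hζ fun htop => hbk ?_
  obtain ⟨g, hg, he⟩ := exists_analyticAt_eventually_eq_pole_add hb hz hlim k hk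
  have h0 := meromorphicOrderAt_eq_top_iff.1 htop
  have hlim0 : Tendsto (fun ζ => b k + (ζ - z k) * g ζ) (𝓝[≠] (z k)) (𝓝 (b k)) := by
    have : ContinuousAt (fun ζ => b k + (ζ - z k) * g ζ) (z k) := by
      have := hg.continuousAt
      fun_prop
    simpa [ContinuousAt] using this.tendsto.mono_left nhdsWithin_le_nhds
  refine tendsto_nhds_unique (hlim0.congr' ?_) tendsto_const_nhds
  filter_upwards [h0, he, self_mem_nhdsWithin] with ζ h1 h2 h3
  have h4 : ζ - z k ≠ 0 := sub_ne_zero.2 h3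
  rw [h1] at h2
  field_simp at h2
  rw [← h2, zero_mul]

theorem analyticOrderAt_cauchySeries_ne_top {ρ : ℝ} {b z : ℕ → ℂ}
    (hb : Summable fun i => ‖b i‖) (hz : Function.Injective z)
    (hlim : Tendsto z atTop (𝓝 (ρ : ℂ))) {k : ℕ} (hk : ‖z k‖ < ρ) (hbk : b k ≠ 0) {ζ : ℂ}
    (hζ : ζ ∈ puncturedDisk ρ z) : analyticOrderAt (cauchySeries b z) ζ ≠ ⊤ := by
  intro h
  apply meromorphicOrderAt_cauchySeries_ne_top hb hz hlim hk hbk hζ.1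
  rw [(analyticAt_cauchySeries_of_mem hb hlim hζ).meromorphicOrderAt_eq, h]
  rfl

/-- Turns identities on the punctured disk into equalities of germs, so that orders can be compared.
-/
theorem puncturedDisk_mem_nhds {ρ : ℝ} {z : ℕ → ℂ} (hlim : Tendsto z atTop (𝓝 (ρ : ℂ)))
    {ζ : ℂ} (hζ : ζ ∈ puncturedDisk ρ z) : puncturedDisk ρ z ∈ 𝓝 ζ := by
  obtain ⟨δ, hδ, h⟩ := puncturedDisk_far hlim hζ
  filter_upwards [Metric.isOpen_ball.mem_nhds hζ.1, Metric.ball_mem_nhds ζ hδ] with u hu hu'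
  refine ⟨hu, ?_⟩
  rintro ⟨i, rfl⟩
  have := h i
  rw [Metric.mem_ball, dist_comm, dist_eq_norm] at hu'
  linarith

/-! ### Dividing out zeros -/

/-- Coefficients divided successively by `z i - w 0, …, z i - w (k - 1)`. -/
noncomputable def dividedCoeff (b z w : ℕ → ℂ) (k i : ℕ) : ℂ :=
  b i / ∏ j ∈ Finset.range k, (z i - w j)

theorem dividedCoeff_zero (b z w : ℕ → ℂ) : dividedCoeff b z w 0 = b := by
  ext i
  simp [dividedCoeff]

theorem dividedCoeff_succ (b z w : ℕ → ℂ) (k : ℕ) :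
    dividedCoeff b z w (k + 1) = fun i => dividedCoeff b z w k i / (z i - w k) := by
  ext i
  simp [dividedCoeff, Finset.prod_range_succ, div_div]

section
variable {ρ : ℝ} {b z : ℕ → ℂ}

theorem summable_norm_div_sub (hb : Summable fun i => ‖b i‖)
    (hlim : Tendsto z atTop (𝓝 (ρ : ℂ))) {ζ : ℂ} (hζ : ζ ∈ puncturedDisk ρ z) :
    Summable fun i => ‖b i / (ζ - z i)‖ := by
  obtain ⟨δ, hδ, h⟩ := puncturedDisk_far hlim hζ
  exact summable_norm_div hb hδ fun i => Or.inr (h i)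

theorem hasSum_div_sub (hb : Summable fun i => ‖b i‖)
    (hlim : Tendsto z atTop (𝓝 (ρ : ℂ))) {w : ℂ} (hw : w ∈ puncturedDisk ρ z) :
    HasSum (fun i => b i / (z i - w)) (-cauchySeries b z w) := by
  refine ((summable_norm_div_sub hb hlim hw).of_norm.hasSum.neg).congr_fun fun i => ?_
  rw [← neg_sub w (z i), div_neg]

theorem summable_norm_div_sub' (hb : Summable fun i => ‖b i‖)
    (hlim : Tendsto z atTop (𝓝 (ρ : ℂ))) {w : ℂ} (hw : w ∈ puncturedDisk ρ z) :
    Summable fun i => ‖b i / (z i - w)‖ := by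
  simpa only [norm_div, norm_sub_rev w] using summable_norm_div_sub hb hlim hw

/-- Dividing the coefficients by `z i - w` at a zero `w` divides the series by `ζ - w`. -/
theorem cauchySeries_eq_sub_mul (hb : Summable fun i => ‖b i‖)
    (hlim : Tendsto z atTop (𝓝 (ρ : ℂ))) {w ζ : ℂ} (hw : w ∈ puncturedDisk ρ z)
    (hζ : ζ ∈ puncturedDisk ρ z) (h0 : cauchySeries b z w = 0) :
    cauchySeries b z ζ = (ζ - w) * cauchySeries (fun i => b i / (z i - w)) z ζ := by
  have h1 := (summable_norm_div_sub (summable_norm_div_sub' hb hlim hw) hlim hζ).of_norm.hasSum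
  have h2 := (hasSum_div_sub hb hlim hw)
  rw [h0, neg_zero] at h2
  have h3 := (h1.mul_left (ζ - w)).sub h2
  rw [sub_zero] at h3
  -- Termwise, `(ζ - w) / ((z i - w) * (ζ - z i)) = 1 / (ζ - z i) + 1 / (z i - w)`; the last part
  -- sums to zero because `w` is a zero.
  refine (h3.congr_fun fun i => ?_).tsum_eq
  have e1 : ζ - z i ≠ 0 := sub_ne_zero.2 fun h => hζ.2 ⟨i, h.symm⟩
  have e2 : z i - w ≠ 0 := sub_ne_zero.2 fun h => hw.2 ⟨i, h⟩
  field_simp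
  ring

theorem analyticOrderAt_prod_sub (w : ℕ → ℂ) (u : ℂ) (k : ℕ) :
    analyticOrderAt (fun ζ => ∏ j ∈ Finset.range k, (ζ - w j)) u =
      ((Finset.range k).filter fun j => w j = u).card := by
  induction k with
  | zero => simp [analyticOrderAt_eq_zero]
  | succ k ih =>
    simp only [Finset.prod_range_succ]
    have := analyticOrderAt_mul (f := fun ζ => ∏ j ∈ Finset.range k, (ζ - w j))
      (g := fun ζ => ζ - w k) (z₀ := u) (by fun_prop) (by fun_prop)
    rw [show (fun ζ => (∏ j ∈ Finset.range k, (ζ - w j)) * (ζ - w k)) =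
      (fun ζ => ∏ j ∈ Finset.range k, (ζ - w j)) * (fun ζ => ζ - w k) from rfl, this, ih,
      Finset.range_add_one, Finset.filter_insert]
    split_ifs with h
    · subst h
      have : analyticOrderAt (fun ζ => ζ - w k) (w k) = (1 : ℕ) := by
        rw [AnalyticAt.analyticOrderAt_eq_natCast (by fun_prop)]
        exact ⟨1, analyticAt_const, one_ne_zero, by simp⟩
      rw [this, Finset.card_insert_of_notMem (by simp)]
      simp
    · have : analyticOrderAt (fun ζ => ζ - w k) u = 0 := by
        rw [analyticOrderAt_eq_zero]
        exact Or.inr (sub_ne_zero.2 (Ne.symm h))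
      rw [this, add_zero]

theorem summable_norm_dividedCoeff (hb : Summable fun i => ‖b i‖)
    (hlim : Tendsto z atTop (𝓝 (ρ : ℂ))) {w : ℕ → ℂ} (hw : ∀ k, w k ∈ puncturedDisk ρ z) (k : ℕ) :
    Summable fun i => ‖dividedCoeff b z w k i‖ := by
  induction k with
  | zero => simpa only [dividedCoeff_zero] using hb
  | succ k ih =>
    rw [dividedCoeff_succ]
    exact summable_norm_div_sub' ih hlim (hw k)

/-- If `w 0, …, w (n - 1)` are zeros of the series, repeated at most according to multiplicity,
then the divided coefficients have vanishing sums. -/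
theorem hasSum_dividedCoeff_zero (hb : Summable fun i => ‖b i‖)
    (hlim : Tendsto z atTop (𝓝 (ρ : ℂ))) {w : ℕ → ℂ} (hw : ∀ k, w k ∈ puncturedDisk ρ z) {n : ℕ}
    (hord : ∀ k < n, (((Finset.range k).filter fun j => w j = w k).card : ℕ∞) <
      analyticOrderAt (cauchySeries b z) (w k)) :
    ∀ k < n, HasSum (dividedCoeff b z w (k + 1)) 0 := by
  have hs := summable_norm_dividedCoeff hb hlim hw
  -- If the cofactor did not vanish at `w k`, the order there would equal the number of earlier
  -- occurrences of `w k`, against `hord`. The factorization is a hypothesis here, as `fac` uses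
  -- `key` at each step of its induction.
  have key : ∀ k ≤ n, (∀ ζ ∈ puncturedDisk ρ z, cauchySeries b z ζ =
      (∏ j ∈ Finset.range k, (ζ - w j)) * cauchySeries (dividedCoeff b z w k) z ζ) →
      k < n → cauchySeries (dividedCoeff b z w k) z (w k) = 0 := by
    intro k _ hfac hk
    by_contra hne
    have ha := analyticAt_cauchySeries_of_mem (hs k) hlim (hw k)
    have hcong : cauchySeries b z =ᶠ[𝓝 (w k)]
        (fun ζ => ∏ j ∈ Finset.range k, (ζ - w j)) * cauchySeries (dividedCoeff b z w k) z :=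
      mem_of_superset (puncturedDisk_mem_nhds hlim (hw k)) hfac
    have := hord k hk
    rw [analyticOrderAt_congr hcong, analyticOrderAt_mul (by fun_prop) ha,
      analyticOrderAt_prod_sub, analyticOrderAt_eq_zero.2 (Or.inr hne), add_zero] at this
    exact lt_irrefl _ this
  have fac : ∀ k ≤ n, ∀ ζ ∈ puncturedDisk ρ z, cauchySeries b z ζ =
      (∏ j ∈ Finset.range k, (ζ - w j)) * cauchySeries (dividedCoeff b z w k) z ζ := by
    intro k
    induction k with
    | zero => simp [dividedCoeff_zero]
    | succ k ih =>
      intro hk ζ hζ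
      have h0 := key k (by omega) (ih (by omega)) hk
      rw [ih (by omega) ζ hζ, cauchySeries_eq_sub_mul (hs k) hlim (hw k) hζ h0,
        Finset.prod_range_succ, dividedCoeff_succ, mul_assoc]
  intro k hk
  have := hasSum_div_sub (hs k) hlim (hw k)
  rwa [key k hk.le (fac k hk.le) hk, neg_zero, ← dividedCoeff_succ] at this

end

/-! ### Jensen's inequality -/

/-- Jensen's inequality for countable convex combinations, with values in `[0, ∞]`. -/
theorem ConvexOn.ofReal_map_le_tsum {Φ : ℂ → ℝ} (hΦ : ConvexOn ℝ univ Φ) (h0 : ∀ x, 0 ≤ Φ x)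
    {p : ℕ → ℝ} {x : ℕ → ℂ} {c : ℂ} (hp : ∀ i, 0 ≤ p i) (hp1 : HasSum p 1)
    (hc : HasSum (fun i => (p i : ℂ) * x i) c) :
    ENNReal.ofReal (Φ c) ≤ ∑' i, ENNReal.ofReal (p i * Φ (x i)) := by
  have hcont : Continuous Φ := by
    simpa [continuousOn_univ] using hΦ.continuousOn isOpen_univ
  have hcm : Tendsto (fun s : Finset ℕ => s.centerMass p x) atTop (𝓝 c) := by
    have := (hp1.inv₀ one_ne_zero).smul hc
    simpa [Finset.centerMass] using this
  -- Weighting by the partial mass makes each term at most a partial sum of the right side,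
  -- including when the mass is zero.
  have hl : Tendsto (fun s : Finset ℕ => ENNReal.ofReal ((∑ i ∈ s, p i) * Φ (s.centerMass p x)))
      atTop (𝓝 (ENNReal.ofReal (1 * Φ c))) :=
    (ENNReal.continuous_ofReal.tendsto _).comp
      (Tendsto.mul hp1 ((hcont.tendsto _).comp hcm))
  rw [one_mul] at hl
  refine le_of_tendsto hl (Eventually.of_forall fun s => ?_)
  refine le_trans ?_ (ENNReal.sum_le_tsum s)
  rw [← ENNReal.ofReal_sum_of_nonneg fun i _ => mul_nonneg (hp i) (h0 _)]
  refine ENNReal.ofReal_le_ofReal ?_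
  rcases (Finset.sum_nonneg fun i (_ : i ∈ s) => hp i).eq_or_lt with hs | hs
  · rw [← hs, zero_mul]
    exact Finset.sum_nonneg fun i _ => mul_nonneg (hp i) (h0 _)
  · have := hΦ.map_centerMass_le (t := s) (fun i _ => hp i) hs (fun i _ => mem_univ (x i))
    calc (∑ i ∈ s, p i) * Φ (s.centerMass p x)
        ≤ (∑ i ∈ s, p i) * s.centerMass p (Φ ∘ x) := by gcongr
      _ = ∑ i ∈ s, p i * Φ (x i) := by
        simp only [Finset.centerMass, smul_eq_mul, Function.comp]
        rw [mul_inv_cancel_left₀ hs.ne']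

/-! ### Triangularizing a compression -/

section Hilbert
open InnerProductSpace Submodule
variable {E : Type*} [NormedAddCommGroup E] [InnerProductSpace ℂ E]

/-- Gram–Schmidt applied to a Jordan-like chain of the compression of `T` to the orthogonal
complement of `v` triangularizes the compression: the chain values are its diagonal entries. -/
theorem inner_gramSchmidtNormed_of_chain (T : E →ₗ[ℂ] E) {y : ℕ → E}
    (hy : LinearIndependent ℂ y) {v : E} {w : ℕ → ℂ} {n : ℕ}
    (hv : ∀ k < n, inner ℂ v (y k) = 0) (h0 : T (y 0) = w 0 • y 0 + v)
    (hs : ∀ k, T (y (k + 1)) = w (k + 1) • y (k + 1) + y k) {k : ℕ} (hk : k < n) :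
    inner ℂ v (gramSchmidtNormed ℂ y k) = 0 ∧
      inner ℂ (gramSchmidtNormed ℂ y k) (T (gramSchmidtNormed ℂ y k)) = w k := by
  set V := span ℂ (y '' Set.Iio k) with hV
  set g := gramSchmidt ℂ y k with hg
  set e := gramSchmidtNormed ℂ y k with he
  have heg : e = (‖g‖ : ℂ)⁻¹ • g := rfl
  -- Modulo earlier chain vectors and `v`, `T` acts on `y j` as `w j`. Since `e` is orthogonal to
  -- `V` and to `v`, this error disappears from the inner product with `e`.
  have hchain : ∀ j ≤ k, T (y j) - w j • y j ∈ V ⊔ span ℂ {v} := by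
    intro j hj
    cases j with
    | zero =>
      rw [h0, add_sub_cancel_left]
      exact mem_sup_right (mem_span_singleton_self v)
    | succ j =>
      rw [hs, add_sub_cancel_left]
      exact mem_sup_left (subset_span ⟨j, by simpa using hj, rfl⟩)
  have hTV : ∀ x ∈ V, T x ∈ V ⊔ span ℂ {v} := by
    intro x hx
    induction hx using span_induction with
    | mem x hx =>
      obtain ⟨j, hj, rfl⟩ := hx
      have h1 : w j • y j ∈ V ⊔ span ℂ {v} :=
        mem_sup_left (V.smul_mem _ (subset_span ⟨j, hj, rfl⟩))
      simpa using add_mem (hchain j (le_of_lt hj)) h1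
    | zero => simp
    | add x x' _ _ hx hx' => rw [map_add]; exact add_mem hx hx'
    | smul c x _ hx => rw [map_smul]; exact smul_mem _ c hx
  have hvg : inner ℂ v g = 0 := by
    have hle : span ℂ (y '' Set.Iic k) ≤ (ℂ ∙ v)ᗮ := by
      refine span_le.2 ?_
      rintro _ ⟨j, hj, rfl⟩
      exact mem_orthogonal_singleton_iff_inner_right.2 (hv j (lt_of_le_of_lt hj hk))
    exact mem_orthogonal_singleton_iff_inner_right.1 (hle (gramSchmidt_mem_span ℂ y le_rfl))
  have hve : inner ℂ v e = 0 := by rw [heg, inner_smul_right, hvg, mul_zero]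
  have hVe : V ⊔ span ℂ {v} ≤ (ℂ ∙ e)ᗮ := by
    refine sup_le ?_ ?_
    · rw [hV, ← span_gramSchmidt_Iio]
      refine span_le.2 ?_
      rintro _ ⟨j, hj, rfl⟩
      refine mem_orthogonal_singleton_iff_inner_right.2 ?_
      rw [heg, inner_smul_left, gramSchmidt_orthogonal ℂ y (ne_of_gt hj), mul_zero]
    · refine span_le.2 ?_
      rintro _ rfl
      exact mem_orthogonal_singleton_iff_inner_right.2 (inner_eq_zero_symm.1 hve)
  have hsV : y k - g ∈ V := by
    have h1 := gramSchmidt_def' ℂ y k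
    rw [← hg] at h1
    rw [sub_eq_iff_eq_add'.2 h1, hV, ← span_gramSchmidt_Iio]
    refine Submodule.sum_mem _ fun j hj => ?_
    rw [starProjection_singleton]
    exact smul_mem _ _ (subset_span ⟨j, by simpa using hj, rfl⟩)
  have hTg : T g - w k • g ∈ V ⊔ span ℂ {v} := by
    have h1 : T g - w k • g = (T (y k) - w k • y k) - (T (y k - g) - w k • (y k - g)) := by
      rw [map_sub, smul_sub]
      abel
    rw [h1]
    exact sub_mem (hchain k le_rfl)
      (sub_mem (hTV _ hsV) (mem_sup_left (V.smul_mem _ hsV)))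
  have hTe : T e - w k • e ∈ V ⊔ span ℂ {v} := by
    have h1 : T e - w k • e = (‖g‖ : ℂ)⁻¹ • (T g - w k • g) := by
      rw [heg, map_smul, smul_sub, smul_comm]
    rw [h1]
    exact smul_mem _ _ hTg
  refine ⟨hve, ?_⟩
  have h1 := mem_orthogonal_singleton_iff_inner_right.1 (hVe hTe)
  rw [inner_sub_right, inner_smul_right, sub_eq_zero] at h1
  rw [h1, inner_self_eq_norm_sq_to_K, he, gramSchmidtNormed_unit_length k hy]
  simp

end Hilbert

/-! ### The diagonal operator and the chain in `ℓ²` -/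

/-- The Hilbert space `ℓ²(ℕ)`. -/
abbrev SqSummable : Type := lp (fun _ : ℕ => ℂ) 2

theorem memlp_two_of_le {f g : ℕ → ℂ} (hf : Memℓp f 2) (C : ℝ) (h : ∀ i, ‖g i‖ ≤ C * ‖f i‖) :
    Memℓp g 2 := by
  refine Memℓp.mono (g := fun i => C * ‖f i‖) ?_ h
  exact hf.norm.const_mul C

/-- The diagonal operator with bounded entries `z i`. -/
noncomputable def diagonalOp (z : ℕ → ℂ) {ρ : ℝ} (hz : ∀ i, ‖z i‖ ≤ ρ) :
    SqSummable →ₗ[ℂ] SqSummable where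
  toFun x := ⟨fun i => z i * x i, memlp_two_of_le x.2 ρ fun i => by
    rw [norm_mul]
    exact mul_le_mul_of_nonneg_right (hz i) (norm_nonneg _)⟩
  map_add' x y := by
    ext i
    exact mul_add _ _ _
  map_smul' c x := by
    ext i
    exact mul_left_comm _ _ _

theorem hasSum_norm_sq (x : SqSummable) : HasSum (fun i => ‖x i‖ ^ 2) (‖x‖ ^ 2) := by
  simpa using lp.hasSum_norm (p := 2) (by simp) x

/-- Entries of a finite orthonormal family orthogonal to a unit vector `v`. -/
theorem sum_norm_sq_apply_le {ι : Type*} {e : ι → SqSummable} (he : Orthonormal ℂ e)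
    {v : SqSummable} (hv : ‖v‖ = 1) (s : Finset ι) (hve : ∀ j ∈ s, inner ℂ v (e j) = 0) (i : ℕ) :
    ∑ j ∈ s, ‖e j i‖ ^ 2 ≤ 1 - ‖v i‖ ^ 2 := by
  set d : SqSummable := lp.single 2 i 1 with hd
  have hdv : inner ℂ v d = (starRingEnd ℂ) (v i) := by
    rw [hd, lp.inner_single_right]
    simp
  -- The projection of the basis vector `d` onto `vᗮ` has the same inner products with the `e j` as
  -- `d`; Bessel is applied to it.
  have hnorm : ‖d - inner ℂ v d • v‖ ^ 2 = 1 - ‖v i‖ ^ 2 := by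
    have hd1 : ‖d‖ = 1 := by simp [hd, lp.norm_single]
    have h1 : inner ℂ (inner ℂ v d • v) (d - inner ℂ v d • v) = 0 := by
      rw [inner_smul_left, inner_sub_right, inner_smul_right, inner_self_eq_norm_sq_to_K, hv]
      simp
    have h2 := norm_add_sq_eq_norm_sq_add_norm_sq_of_inner_eq_zero _ _ h1
    rw [add_sub_cancel, hd1, norm_smul, hv] at h2
    rw [show ‖v i‖ = ‖inner ℂ v d‖ by rw [hdv, RCLike.norm_conj]]
    nlinarith
  rw [← hnorm]
  refine le_trans (le_of_eq (Finset.sum_congr rfl fun j hj => ?_))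
    (he.sum_inner_products_le (s := s) (d - inner ℂ v d • v))
  rw [inner_sub_right, inner_smul_right, inner_eq_zero_symm.1 (hve j hj), mul_zero, sub_zero, hd,
    lp.inner_single_right]
  simp

section
variable {ρ : ℝ} {z w : ℕ → ℂ}

theorem memlp_dividedCoeff {b : ℕ → ℂ} (hb : Memℓp b 2) (hlim : Tendsto z atTop (𝓝 (ρ : ℂ)))
    (hw : ∀ k, w k ∈ puncturedDisk ρ z) (k : ℕ) : Memℓp (dividedCoeff b z w k) 2 := by
  induction k with
  | zero => rwa [dividedCoeff_zero]
  | succ k ih =>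
    rw [dividedCoeff_succ]
    obtain ⟨δ, hδ, h⟩ := puncturedDisk_far hlim (hw k)
    refine memlp_two_of_le ih δ⁻¹ fun i => ?_
    rw [norm_div, div_eq_inv_mul, norm_sub_rev]
    gcongr
    exact h i

/-- Successive divided coefficient sequences are linearly independent: a relation would be a
nonzero polynomial vanishing at infinitely many points. -/
theorem linearIndependent_dividedCoeff {b : ℕ → ℂ} (hb : ∀ i, b i ≠ 0)
    (hz : Function.Injective z) (hw : ∀ k, w k ∈ puncturedDisk ρ z) :
    LinearIndependent ℂ fun k => dividedCoeff b z w (k + 1) := by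
  have hne : ∀ i j, z i - w j ≠ 0 := fun i j => sub_ne_zero.2 fun h => (hw j).2 ⟨i, h⟩
  rw [linearIndependent_iff']
  intro s c hsum
  by_contra! hcon
  have hT : (s.filter fun k => c k ≠ 0).Nonempty := by
    obtain ⟨k, hk, hck⟩ := hcon
    exact ⟨k, Finset.mem_filter.2 ⟨hk, hck⟩⟩
  set t := s.filter fun k => c k ≠ 0
  set N := t.max' hT
  have hN : N ∈ t := t.max'_mem hT
  -- The relation cleared of denominators. As `N` is the largest index with a nonzero coefficient,
  -- every term but the `N`-th contains the factor `X - w N`.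
  let P : Polynomial ℂ := ∑ k ∈ t, Polynomial.C (c k) *
    ∏ j ∈ Finset.Ico (k + 1) (N + 1), (Polynomial.X - Polynomial.C (w j))
  have heval : ∀ u, P.eval u = ∑ k ∈ t, c k * ∏ j ∈ Finset.Ico (k + 1) (N + 1), (u - w j) := by
    intro u
    simp [P, Polynomial.eval_finsetSum, Polynomial.eval_prod]
  have hroot : ∀ i, P.eval (z i) = 0 := by
    intro i
    have h1 : ∑ k ∈ t, c k * dividedCoeff b z w (k + 1) i = 0 := by
      have := congrFun hsum i
      rw [Finset.sum_apply] at this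
      simp only [Pi.smul_apply, smul_eq_mul, Pi.zero_apply] at this
      rw [← this, Finset.sum_filter]
      refine Finset.sum_congr rfl fun k _ => ?_
      split_ifs with h
      · rfl
      · rw [not_not.1 h, zero_mul]
    have h2 : P.eval (z i) = ((∏ j ∈ Finset.range (N + 1), (z i - w j)) / b i) *
        ∑ k ∈ t, c k * dividedCoeff b z w (k + 1) i := by
      rw [heval, Finset.mul_sum]
      refine Finset.sum_congr rfl fun k hk => ?_
      have hkN : k + 1 ≤ N + 1 := Nat.succ_le_succ (t.le_max' k hk)
      have hp : ∏ j ∈ Finset.range (k + 1), (z i - w j) ≠ 0 :=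
        Finset.prod_ne_zero_iff.2 fun j _ => hne i j
      rw [← Finset.prod_range_mul_prod_Ico _ hkN, dividedCoeff]
      have := hb i
      field_simp
    rw [h2, h1, mul_zero]
  have hP : P = 0 := by
    refine Polynomial.eq_zero_of_infinite_isRoot P ((infinite_range_of_injective hz).mono ?_)
    rintro _ ⟨i, rfl⟩
    exact hroot i
  have hcN : P.eval (w N) = c N := by
    rw [heval, Finset.sum_eq_single_of_mem N hN]
    · simp
    · intro k hk hkN
      have hlt : k < N := lt_of_le_of_ne (t.le_max' k hk) hkN
      rw [Finset.prod_eq_zero (i := N) (by simp; omega) (sub_self _), mul_zero]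
  rw [hP, Polynomial.eval_zero] at hcN
  exact (Finset.mem_filter.1 hN).2 hcN.symm

end

/-! ### The inequality for finite lists of zeros -/

/-- The convex-function inequality for finitely many zeros, repeated at most according to
multiplicity. -/
theorem sum_ofReal_map_zero_le {ρ : ℝ} {a : ℕ → ℝ} {z : ℕ → ℂ}
    (hz : Function.Injective z) (ha : ∀ i, 0 < a i) (hzρ : ∀ i, ‖z i‖ < ρ)
    (hsum : HasSum a 1) (hlim : Tendsto z atTop (𝓝 (ρ : ℂ)))
    {w : ℕ → ℂ} (hw : ∀ k, w k ∈ puncturedDisk ρ z) {n : ℕ}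
    (hord : ∀ k < n, (((Finset.range k).filter fun j => w j = w k).card : ℕ∞) <
      analyticOrderAt (borelField a z) (w k))
    (l m : ℂ) {Φ : ℂ → ℝ} (hΦ : ConvexOn ℝ univ Φ) (h0 : ∀ x, 0 ≤ Φ x) :
    ∑ k ∈ Finset.range n, ENNReal.ofReal (Φ (l * w k + m)) ≤
      ∑' i, ENNReal.ofReal ((1 - a i) * Φ (l * z i + m)) := by
  set r : ℕ → ℂ := fun i => (Real.sqrt (a i) : ℂ) with hr
  have hrnorm : ∀ i, ‖r i‖ ^ 2 = a i := fun i => by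
    rw [hr, Complex.norm_real, Real.norm_eq_abs, sq_abs, Real.sq_sqrt (ha i).le]
  have hrne : ∀ i, r i ≠ 0 := fun i => by
    simpa [hr] using (Real.sqrt_pos.2 (ha i)).ne'
  have hrmem : Memℓp r 2 := by
    refine memℓp_gen ?_
    simpa [hrnorm] using hsum.summable
  have hne : ∀ i j, z i - w j ≠ 0 := fun i j => sub_ne_zero.2 fun h => (hw j).2 ⟨i, h⟩
  let v : SqSummable := ⟨r, hrmem⟩
  let y : ℕ → SqSummable := fun k =>
    ⟨dividedCoeff r z w (k + 1), memlp_dividedCoeff hrmem hlim hw (k + 1)⟩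
  let T := diagonalOp z fun i => (hzρ i).le
  have hv1 : ‖v‖ = 1 := by
    have h1 := (hasSum_norm_sq v).unique
      (hsum.congr_fun fun i => hrnorm i)
    nlinarith [norm_nonneg v]
  have hy : LinearIndependent ℂ y := by
    have := linearIndependent_dividedCoeff (ρ := ρ) (b := r) hrne hz hw
    refine LinearIndependent.of_comp
      (⟨⟨fun x => (x : ℕ → ℂ), fun _ _ => rfl⟩, fun _ _ => rfl⟩ : SqSummable →ₗ[ℂ] (ℕ → ℂ)) this
  -- Pairing with `v` supplies a second `√a i`, so the inner product is the sum of the divided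
  -- coefficients of `a`.
  have hvy : ∀ k < n, inner ℂ v (y k) = 0 := by
    intro k hk
    have hs : Summable fun i => ‖(a i : ℂ)‖ := by
      simpa [abs_of_pos (ha _)] using hsum.summable
    have h1 := hasSum_dividedCoeff_zero hs hlim hw hord k hk
    refine (lp.hasSum_inner (𝕜 := ℂ) v (y k)).unique (h1.congr_fun fun i => ?_)
    have h2 : (a i : ℂ) = r i * r i := by
      rw [hr, ← Complex.ofReal_mul, Real.mul_self_sqrt (ha i).le]
    change inner ℂ (r i) (dividedCoeff r z w (k + 1) i) = _
    rw [dividedCoeff, dividedCoeff, h2, RCLike.inner_apply, hr, Complex.conj_ofReal]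
    ring
  have hT0 : T (y 0) = w 0 • y 0 + v := by
    ext i
    change z i * dividedCoeff r z w 1 i = w 0 * dividedCoeff r z w 1 i + r i
    have := hne i 0
    rw [dividedCoeff, Finset.prod_range_one]
    field_simp
    ring
  have hTs : ∀ k, T (y (k + 1)) = w (k + 1) • y (k + 1) + y k := by
    intro k
    ext i
    change z i * dividedCoeff r z w (k + 1 + 1) i =
      w (k + 1) * dividedCoeff r z w (k + 1 + 1) i + dividedCoeff r z w (k + 1) i
    have := hne i (k + 1)
    rw [dividedCoeff_succ _ _ _ (k + 1)]
    field_simp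
    ring
  set e := InnerProductSpace.gramSchmidtNormed ℂ y with he
  have hon : Orthonormal ℂ e := InnerProductSpace.gramSchmidtNormed_orthonormal hy
  have hchain : ∀ k < n, inner ℂ v (e k) = 0 ∧ inner ℂ (e k) (T (e k)) = w k := fun k hk =>
    inner_gramSchmidtNormed_of_chain T hy hvy hT0 hTs hk
  have hjensen : ∀ k < n, ENNReal.ofReal (Φ (l * w k + m)) ≤
      ∑' i, ENNReal.ofReal (‖e k i‖ ^ 2 * Φ (l * z i + m)) := by
    intro k hk
    have hp : HasSum (fun i => ‖e k i‖ ^ 2) 1 := by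
      simpa [hon.1 k] using hasSum_norm_sq (e k)
    refine hΦ.ofReal_map_le_tsum h0 (fun i => by positivity) hp ?_
    -- Expanding `⟨e k, T (e k)⟩ = w k` in coordinates exhibits `w k` as the barycenter of the `z
    -- i`.
    have h1 := lp.hasSum_inner (𝕜 := ℂ) (e k) (T (e k))
    rw [(hchain k hk).2] at h1
    have h2 : HasSum (fun i => ((‖e k i‖ ^ 2 : ℝ) : ℂ)) ((1 : ℝ) : ℂ) := Complex.hasSum_ofReal.2 hp
    have h3 := (h1.mul_left l).add (h2.mul_right m)
    rw [Complex.ofReal_one, one_mul] at h3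
    refine h3.congr_fun fun i => ?_
    change _ = l * inner ℂ (e k i) (z i * e k i) + _
    rw [RCLike.inner_apply, mul_assoc (z i), RCLike.mul_conj]
    push_cast
    simp only [Complex.coe_algebraMap]
    ring
  calc ∑ k ∈ Finset.range n, ENNReal.ofReal (Φ (l * w k + m))
      ≤ ∑ k ∈ Finset.range n, ∑' i, ENNReal.ofReal (‖e k i‖ ^ 2 * Φ (l * z i + m)) :=
        Finset.sum_le_sum fun k hk => hjensen k (Finset.mem_range.1 hk)
    _ = ∑' i, ∑ k ∈ Finset.range n, ENNReal.ofReal (‖e k i‖ ^ 2 * Φ (l * z i + m)) :=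
        (Summable.tsum_finsetSum fun _ _ => ENNReal.summable).symm
    _ ≤ ∑' i, ENNReal.ofReal ((1 - a i) * Φ (l * z i + m)) := by
        refine ENNReal.tsum_le_tsum fun i => ?_
        rw [← ENNReal.ofReal_sum_of_nonneg fun k _ => mul_nonneg (by positivity) (h0 _),
          ← Finset.sum_mul]
        refine ENNReal.ofReal_le_ofReal (mul_le_mul_of_nonneg_right ?_ (h0 _))
        have := sum_norm_sq_apply_le hon hv1 (Finset.range n)
          (fun j hj => (hchain j (Finset.mem_range.1 hj)).1) i
        rwa [show ‖v i‖ ^ 2 = a i from hrnorm i] at this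

/-! ### Multiplicities and the final theorem -/

/-- A finite family of points can be enumerated with prescribed multiplicities. -/
theorem exists_enumeration_with_multiplicity (S : Finset ℂ) (M : ℂ → ℕ) (w₀ : ℂ) :
    ∃ (n : ℕ) (w : ℕ → ℂ), (∀ k, w k ∈ S ∨ w k = w₀) ∧
      (∀ k < n, ((Finset.range k).filter fun j => w j = w k).card < M (w k)) ∧
      ∀ φ : ℂ → ℝ≥0∞, ∑ k ∈ Finset.range n, φ (w k) = ∑ u ∈ S, (M u : ℝ≥0∞) * φ u := by
  let I := Σ u : S, Fin (M u)
  let f := (Fintype.equivFin I).symm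
  refine ⟨Fintype.card I, fun k => if h : k < Fintype.card I then (f ⟨k, h⟩).1 else w₀,
    fun k => ?_, fun k hk => ?_, fun φ => ?_⟩
  · dsimp only
    split_ifs with h
    · exact Or.inl (f ⟨k, h⟩).1.2
    · exact Or.inr rfl
  · beta_reduce
    have hkk : (if h : k < Fintype.card I then ((f ⟨k, h⟩).1 : ℂ) else w₀) = (f ⟨k, hk⟩).1 :=
      dif_pos hk
    rw [hkk]
    -- Index `k` is itself an occurrence of its point, whence the strict inequality; the occurrences
    -- up to `k` inject into the `Fin` component.
    have hlt : ((Finset.range k).filter fun j =>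
        (if h : j < Fintype.card I then ((f ⟨j, h⟩).1 : ℂ) else w₀) = (f ⟨k, hk⟩).1).card <
        ((Finset.range (k + 1)).filter fun j =>
        (if h : j < Fintype.card I then ((f ⟨j, h⟩).1 : ℂ) else w₀) = (f ⟨k, hk⟩).1).card := by
      refine Finset.card_lt_card ⟨Finset.filter_subset_filter _ (by simp), fun hsub => ?_⟩
      have : k ∈ Finset.range k :=
        (Finset.mem_filter.1 (hsub (Finset.mem_filter.2 ⟨by simp, hkk⟩))).1
      simp at this
    refine hlt.trans_le ?_
    have hmaps : ∀ j ∈ (Finset.range (k + 1)).filter (fun j =>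
        (if h : j < Fintype.card I then ((f ⟨j, h⟩).1 : ℂ) else w₀) = (f ⟨k, hk⟩).1),
        ∃ h : j < Fintype.card I, (f ⟨j, h⟩).1 = (f ⟨k, hk⟩).1 := by
      intro j hj
      obtain ⟨hj1, hj2⟩ := Finset.mem_filter.1 hj
      have hj3 : j < Fintype.card I := by
        have := Finset.mem_range.1 hj1
        omega
      rw [dif_pos hj3] at hj2
      exact ⟨hj3, Subtype.ext hj2⟩
    calc _ ≤ (Finset.range (M (f ⟨k, hk⟩).1)).card := by
          refine Finset.card_le_card_of_injOn
            (fun j => if h : j < Fintype.card I then ((f ⟨j, h⟩).2 : ℕ) else 0) ?_ ?_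
          · intro j hj
            obtain ⟨h, h'⟩ := hmaps j hj
            simp only [dif_pos h, Finset.coe_range, mem_Iio]
            rw [← h']
            exact (f ⟨j, h⟩).2.2
          · intro i hi j hj hij
            obtain ⟨h1, h1'⟩ := hmaps i hi
            obtain ⟨h2, h2'⟩ := hmaps j hj
            simp only [dif_pos h1, dif_pos h2] at hij
            have h3 : f ⟨i, h1⟩ = f ⟨j, h2⟩ := by
              refine Sigma.ext (h1'.trans h2'.symm) ?_
              rw [Fin.heq_ext_iff (by rw [h1', h2'])]
              exact hij
            simpa using f.injective h3
      _ = _ := Finset.card_range _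
  · rw [Finset.sum_range]
    have h1 : ∀ k : Fin (Fintype.card I),
        φ (if h : (k : ℕ) < Fintype.card I then ((f ⟨k, h⟩).1 : ℂ) else w₀) = φ (f k).1 := by
      intro k
      rw [dif_pos k.2]
    rw [Finset.sum_congr rfl fun k _ => h1 k, Equiv.sum_comp f fun x : I => φ x.1,
      Fintype.sum_sigma, ← Finset.sum_coe_sort S]
    simp

theorem theorem3p10 (ρ : ℝ) (hρ : 0 < ρ) (a : ℕ → ℝ) (z : ℕ → ℂ)
    (hz : Function.Injective z) (ha : ∀ i, 0 < a i) (hzρ : ∀ i, ‖z i‖ < ρ)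
    (hsum : HasSum a 1) (hlim : Tendsto z atTop (𝓝 (ρ : ℂ))) :
    -- `f` is a well-defined meromorphic function in the disk, with a discrete set of zeros
    (∀ ζ ∈ puncturedDisk ρ z, Summable fun i => ‖(a i : ℂ) / (ζ - z i)‖) ∧
    AnalyticOnNhd ℂ (borelField a z) (puncturedDisk ρ z) ∧
    MeromorphicOn (borelField a z) (Metric.ball (0 : ℂ) ρ) ∧
    (∀ ζ ∈ Metric.ball (0 : ℂ) ρ, ∀ᶠ w in 𝓝[≠] ζ, w ∉ fieldZeros ρ a z) ∧
    -- the inequality in `[0, ∞]`, zeros being counted with multiplicity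
    ((fieldZeros ρ a z).Nonempty →
      ∀ l : ℂ, l ≠ 0 → ∀ m : ℂ, ∀ Φ : ℂ → ℝ, ConvexOn ℝ Set.univ Φ → (∀ x, 0 ≤ Φ x) →
        ∑' w : fieldZeros ρ a z,
            (analyticOrderAt (borelField a z) (w : ℂ) : ℝ≥0∞) *
              ENNReal.ofReal (Φ (l * (w : ℂ) + m)) ≤
          ∑' i, ENNReal.ofReal ((1 - a i) * Φ (l * z i + m))) := by
  have hs : Summable fun i => ‖(a i : ℂ)‖ := by
    simpa [abs_of_pos (ha _)] using hsum.summable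
  have ha0 : (a 0 : ℂ) ≠ 0 := by exact_mod_cast (ha 0).ne'
  have hmer : MeromorphicOn (borelField a z) (Metric.ball (0 : ℂ) ρ) :=
    meromorphicOn_cauchySeries hs hz hlim
  refine ⟨fun ζ hζ => summable_norm_div_sub hs hlim hζ,
    fun ζ hζ => analyticAt_cauchySeries_of_mem hs hlim hζ, hmer, fun ζ hζ => ?_, ?_⟩
  · have htop : meromorphicOrderAt (borelField a z) ζ ≠ ⊤ :=
      meromorphicOrderAt_cauchySeries_ne_top hs hz hlim (hzρ 0) ha0 hζ
    filter_upwards [(meromorphicOrderAt_ne_top_iff_eventually_ne_zero (hmer ζ hζ)).1 htop]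
      with w hw hw' using hw hw'.2
  -- The zero `w₀` pads the finite enumeration to a sequence lying wholly in the punctured disk.
  · rintro ⟨w₀, hw₀⟩ l - m Φ hΦ h0
    set M : ℂ → ℕ := fun u => (analyticOrderAt (borelField a z) u).toNat with hM
    have hMeq : ∀ u ∈ fieldZeros ρ a z, (M u : ℕ∞) = analyticOrderAt (borelField a z) u :=
      fun u hu => ENat.natCast_toNat
        (analyticOrderAt_cauchySeries_ne_top hs hz hlim (hzρ 0) ha0 hu.1)
    refine ENNReal.summable.tsum_le_of_sum_le fun S => ?_
    obtain ⟨n, w, hmem, hcount, hφ⟩ :=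
      exists_enumeration_with_multiplicity (S.map (Function.Embedding.subtype _)) M w₀
    have hwz : ∀ k, w k ∈ fieldZeros ρ a z := by
      intro k
      rcases hmem k with h | h
      · obtain ⟨u, _, hu⟩ := Finset.mem_map.1 h
        rw [← hu]
        exact u.2
      · rwa [h]
    have hmain := sum_ofReal_map_zero_le hz ha hzρ hsum hlim (fun k => (hwz k).1) (n := n)
      (fun k hk => by
        rw [← hMeq _ (hwz k)]
        exact_mod_cast hcount k hk) l m hΦ h0
    rw [hφ fun u => ENNReal.ofReal (Φ (l * u + m)), Finset.sum_map] at hmain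
    refine le_trans (le_of_eq (Finset.sum_congr rfl fun u _ => ?_)) hmain
    rw [← hMeq _ u.2]
    simp
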